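/- For each $\lambda>0$ let $N_1,N_2,\dots\sim\mathrm{Poisson}(\lambda)$ and $U_1,U_2,\dots\sim\mathrm{Uniform}(0,1)$ be random variables, all mutually independent, on a probability space $(\Omega_\lambda,\mathbb P_\lambda)$, and put $Z_i=N_i+U_i$. For each $n\ge 1$ let $\widehat{\mathrm{Median}}(Z_1,\dots,Z_n)$ be a sample median, i.e. any real number $m$ (chosen for each outcome) such that at least $n/2$ of the values $Z_1,\dots,Z_n$ are $\le m$ and at least $n/2$ of them are $\ge m$. Then $$\widehat{\mathrm{Median}}(Z_1,\dots,Z_n)-\tfrac13\ \stackrel{\mathbb P}{\longrightarrow}\ \lambda\qquad\text{as } n\to\infty \text{ and then } \lambda\to\infty,$$ in the following sense of an iterated limit. (i) For every fixed $\lambda>0$, $\widehat{\mathrm{Median}}(Z_1,\dots,Z_n)-\tfrac13$ converges in probability, as $n\to\infty$, to $\mathrm{Median}(Z_1)-\tfrac13$, where $\mathrm{Median}(Z_1)=\inf\{x\in\mathbb R:\mathbb P_\lambda(Z_1\le x)\ge \tfrac12\}$. (ii) For every $\varepsilon>0$ there is $\lambda_0>0$ such that for every $\lambda\ge\lambda_0$,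 $$\lim_{n\to\infty}\mathbb P_\lambda\Big(\big|\widehat{\mathrm{Median}}(Z_1,\dots,Z_n)-\tfrac13-\lambda\big|\ge\varepsilon\Big)=0 .$$ (Where the chosen sample median is not measurable, probabilities are understood as outer probabilities.) -/

import Mathlib

open MeasureTheory ProbabilityTheory Filter Topology
open scoped NNReal

/-- The median `inf {x : P(X ≤ x) ≥ 1/2}` of a real random variable `X`. -/
noncomputable def rvMedian {Ω : Type*} [MeasurableSpace Ω] (P : Measure Ω) (X : Ω → ℝ) : ℝ :=
  sInf {x : ℝ | 1 / 2 ≤ P.real {ω | X ω ≤ x}}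

/-- `m` is a sample median of `z 0, …, z (n - 1)`: at least half of the observations are `≤ m`
and at least half of them are `≥ m`. For odd `n` this says that `m` is the middle order statistic;
for even `n` it says that `m` lies between the two middle order statistics (both included), so
every usual convention (lower median, upper median, midpoint) is covered. -/
def IsSampleMedian {n : ℕ} (z : Fin n → ℝ) (m : ℝ) : Prop :=
  n ≤ 2 * Nat.card {i : Fin n // z i ≤ m} ∧ n ≤ 2 * Nat.card {i : Fin n // m ≤ z i}

/-- `N 0, N 1, …` are Poisson with mean `lam`, `U 0, U 1, …` are uniform on `(0, 1)`,
and all these random variables together are mutually independent. -/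
structure IsPoissonUniformSample {Ω : Type*} [MeasurableSpace Ω] (P : Measure Ω) (lam : ℝ≥0)
    (N : ℕ → Ω → ℕ) (U : ℕ → Ω → ℝ) : Prop where
  hasLaw_poisson : ∀ i, HasLaw (N i) (poissonMeasure lam) P
  isUniform : ∀ i, pdf.IsUniform (U i) (Set.Ioo (0 : ℝ) 1) P
  indep : iIndepFun (Sum.elim (fun i ω => (N i ω : ℝ)) U) P

/-- The jittered Poisson observations `Z i = N i + U i`. -/
def jittered {Ω : Type*} (N : ℕ → Ω → ℕ) (U : ℕ → Ω → ℝ) (i : ℕ) (ω : Ω) : ℝ :=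
  (N i ω : ℝ) + U i ω

/-!
For Poisson mean `s`, the distribution function of `N + U` at `k + t` with `0 ≤ t ≤ 1` is
`F(s, k, t) = P(N < k) + t P(N = k)`. Put `s = k + d`. Expanding to second order around `s = k`,
raising both the mean and the level by one changes `F` by `pₖ ((d + 1/3 - t) / (2k) + O(k⁻²))`,
uniformly in `|d| ≤ 1` and `t`, where `pₖ` is the mass at `k` of the Poisson law with mean `k`.
The central limit theorem gives `F(k + d, k, t) → 1/2` as `k → ∞`. Since the sequence is eventually
strictly monotone, in the direction given by the sign of `t - d - 1/3`, it lies eventually strictly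
on the corresponding side of `1/2`. As the level is the mean plus `t - d`, the median for mean `λ`
is `λ + 1/3 + o(1)`. The law of large numbers, applied to the frequencies of observations in
half-lines, transfers this to sample medians.
-/

/-- The mass `e⁻ˢ sᵏ / k!` of the Poisson law with mean `s` at `k`, as a function of a real
parameter `s`, so that it can be differentiated in the mean. -/
noncomputable def poissonMass (s : ℝ) (k : ℕ) : ℝ := Real.exp (-s) * s ^ k / k.factorial

/-- The mass of `{0, …, k - 1}` under the Poisson law with mean `s`. -/
noncomputable def poissonBelow (s : ℝ) (k : ℕ) : ℝ := ∑ j ∈ Finset.range k, poissonMass s j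

/-- The distribution function at `k + t`, for `0 ≤ t ≤ 1`, of the sum of a Poisson variable with
mean `s` and an independent uniform variable on `(0, 1)`. -/
noncomputable def jitteredPoissonCDF (s : ℝ) (k : ℕ) (t : ℝ) : ℝ :=
  poissonBelow s k + t * poissonMass s k

lemma poissonMass_pos {s : ℝ} (hs : 0 < s) (k : ℕ) : 0 < poissonMass s k := by
  unfold poissonMass; positivity

lemma poissonMass_succ (s : ℝ) (k : ℕ) :
    poissonMass s (k + 1) = s / (k + 1) * poissonMass s k := by
  simp only [poissonMass, Nat.factorial_succ, Nat.cast_mul, Nat.cast_succ]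
  field_simp
  ring

lemma poissonBelow_succ (s : ℝ) (k : ℕ) :
    poissonBelow s (k + 1) = poissonBelow s k + poissonMass s k :=
  Finset.sum_range_succ _ _

lemma hasDerivAt_poissonMass_succ (k : ℕ) (s : ℝ) :
    HasDerivAt (poissonMass · (k + 1)) (poissonMass s k - poissonMass s (k + 1)) s := by
  have h := ((hasDerivAt_neg s).exp.mul (hasDerivAt_pow (k + 1) s)).div_const
    ((k + 1).factorial : ℝ)
  refine h.congr_deriv ?_
  simp only [poissonMass, Nat.factorial_succ, Nat.cast_mul, Nat.cast_succ, Nat.add_sub_cancel]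
  field_simp
  ring

lemma hasDerivAt_poissonBelow_succ (k : ℕ) (s : ℝ) :
    HasDerivAt (poissonBelow · (k + 1)) (-poissonMass s k) s := by
  induction k with
  | zero => simpa [poissonBelow, poissonMass] using (hasDerivAt_neg s).exp
  | succ k ih =>
    simp_rw [poissonBelow_succ _ (k + 1)]
    exact (ih.add (hasDerivAt_poissonMass_succ k s)).congr_deriv (by ring)

lemma poissonMass_add {k : ℕ} {u : ℝ} (hk : 0 < k) (hu : -k < u) :
    poissonMass (k + u) k = Real.exp (k * Real.log (1 + u / k) - u) * poissonMass k k := by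
  have hk' : (0 : ℝ) < k := by exact_mod_cast hk
  have hfactor : (k : ℝ) + u = k * (1 + u / k) := by field_simp
  have hpos : 0 < 1 + u / k := pos_of_mul_pos_right (hfactor ▸ by linarith) hk'.le
  have hpow : ((k : ℝ) + u) ^ k = k ^ k * (1 + u / k) ^ k := by rw [hfactor, mul_pow]
  rw [Real.exp_sub, Real.exp_nat_mul, Real.exp_log hpos]
  simp only [poissonMass, hpow, neg_add, Real.exp_add, Real.exp_neg]
  field_simp

lemma abs_log_one_add_sub_le {x : ℝ} (hx : |x| ≤ 1 / 2) :
    |Real.log (1 + x) - (x - x ^ 2 / 2)| ≤ 2 * |x| ^ 3 := by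
  have h := Real.abs_log_sub_add_sum_range_le (x := -x) (by rw [abs_neg]; linarith) 2
  simp only [Finset.sum_range_succ, Finset.sum_range_zero, abs_neg] at h
  calc |Real.log (1 + x) - (x - x ^ 2 / 2)| ≤ |x| ^ 3 / (1 - |x|) := by
        convert! h using 2
        norm_num
        ring
    _ ≤ 2 * |x| ^ 3 := by
        rw [div_le_iff₀ (by linarith)]
        nlinarith [pow_nonneg (abs_nonneg x) 3]

lemma abs_mul_log_one_add_div_sub_le {k u : ℝ} (hk : 4 ≤ k) (hu : |u| ≤ 2) :
    |k * Real.log (1 + u / k) - u + u ^ 2 / (2 * k)| ≤ 16 / k ^ 2 := by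
  have hk0 : 0 < k := by linarith
  have huk : |u / k| = |u| / k := by rw [abs_div, abs_of_pos hk0]
  have hsmall : |u / k| ≤ 1 / 2 := by rw [huk, div_le_iff₀ hk0]; linarith
  calc |k * Real.log (1 + u / k) - u + u ^ 2 / (2 * k)|
      = k * |Real.log (1 + u / k) - (u / k - (u / k) ^ 2 / 2)| := by
        rw [← abs_of_pos hk0, ← abs_mul, abs_of_pos hk0]
        congr 1
        field_simp
        ring
    _ ≤ k * (2 * |u / k| ^ 3) := by gcongr; exact abs_log_one_add_sub_le hsmall
    _ = 2 * |u| ^ 3 / k ^ 2 := by rw [huk]; field_simp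
    _ ≤ 2 * 2 ^ 3 / k ^ 2 := by gcongr
    _ = 16 / k ^ 2 := by norm_num

lemma abs_mul_log_one_add_div_sub_self_le {k u : ℝ} (hk : 4 ≤ k) (hu : |u| ≤ 2) :
    |k * Real.log (1 + u / k) - u| ≤ 6 / k := by
  have hk0 : 0 < k := by linarith
  have hquadratic : |u ^ 2 / (2 * k)| ≤ 2 / k := by
    rw [abs_of_nonneg (by positivity), div_le_div_iff₀ (by positivity) hk0]
    nlinarith [sq_le_sq' (abs_le.1 hu).1 (abs_le.1 hu).2]
  have hremainder : 16 / k ^ 2 ≤ 4 / k := by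
    rw [div_le_div_iff₀ (by positivity) hk0]
    nlinarith
  calc |k * Real.log (1 + u / k) - u|
      = |(k * Real.log (1 + u / k) - u + u ^ 2 / (2 * k)) - u ^ 2 / (2 * k)| := by
        rw [add_sub_cancel_right]
    _ ≤ 16 / k ^ 2 + 2 / k :=
        (abs_sub _ _).trans (add_le_add (abs_mul_log_one_add_div_sub_le hk hu) hquadratic)
    _ ≤ 4 / k + 2 / k := by gcongr
    _ = 6 / k := by ring

lemma abs_poissonMass_add_sub_le {k : ℕ} {u : ℝ} (hk : 6 ≤ k) (hu : |u| ≤ 2) :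
    |poissonMass (k + u) k - (1 - u ^ 2 / (2 * k)) * poissonMass k k| ≤
      52 / (k : ℝ) ^ 2 * poissonMass k k := by
  have hk' : (6 : ℝ) ≤ k := by exact_mod_cast hk
  have hk0 : (0 : ℝ) < k := by linarith
  set y : ℝ := k * Real.log (1 + u / k) - u
  have hy : |y + u ^ 2 / (2 * k)| ≤ 16 / (k : ℝ) ^ 2 :=
    abs_mul_log_one_add_div_sub_le (by linarith) hu
  have hy_le : |y| ≤ 6 / (k : ℝ) := abs_mul_log_one_add_div_sub_self_le (by linarith) hu
  have hexp : |Real.exp y - 1 - y| ≤ 36 / (k : ℝ) ^ 2 := by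
    calc |Real.exp y - 1 - y| ≤ y ^ 2 :=
          Real.abs_exp_sub_one_sub_id_le (hy_le.trans ((div_le_one hk0).2 hk'))
      _ = |y| ^ 2 := (sq_abs y).symm
      _ ≤ (6 / (k : ℝ)) ^ 2 := by gcongr
      _ = 36 / (k : ℝ) ^ 2 := by rw [div_pow]; norm_num
  have hratio : |Real.exp y - (1 - u ^ 2 / (2 * k))| ≤ 52 / (k : ℝ) ^ 2 := by
    calc |Real.exp y - (1 - u ^ 2 / (2 * k))|
        = |(Real.exp y - 1 - y) + (y + u ^ 2 / (2 * k))| := by congr 1; ring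
      _ ≤ 36 / (k : ℝ) ^ 2 + 16 / (k : ℝ) ^ 2 := (abs_add_le _ _).trans (add_le_add hexp hy)
      _ = 52 / (k : ℝ) ^ 2 := by ring
  have hp := (poissonMass_pos hk0 k).le
  rw [poissonMass_add (by omega) (by linarith [(abs_le.1 hu).1]), ← sub_mul, abs_mul,
    abs_of_nonneg hp]
  exact mul_le_mul_of_nonneg_right hratio hp

lemma abs_poissonBelow_add_one_sub_le {k : ℕ} {d : ℝ} (hk : 6 ≤ k) (hd : |d| ≤ 1) :
    |poissonBelow (k + d + 1) (k + 1) - poissonBelow (k + d) (k + 1) +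
        (1 - (d ^ 2 + d + 1 / 3) / (2 * k)) * poissonMass k k| ≤
      52 / (k : ℝ) ^ 2 * poissonMass k k := by
  set p := poissonMass k k
  obtain ⟨hd₁, hd₂⟩ := abs_le.1 hd
  -- The cubic is an antiderivative of the quadratic approximating the mass, so the mean value
  -- inequality on `[d, d + 1]` turns the pointwise bound on the mass into one on the increment.
  have hderiv : ∀ u ∈ Set.Icc (-2 : ℝ) 2, HasDerivWithinAt
      (fun u : ℝ => poissonBelow (k + u) (k + 1) + (u - u ^ 3 / (6 * k)) * p)
      (-poissonMass (k + u) k + (1 - u ^ 2 / (2 * k)) * p) (Set.Icc (-2) 2) u := fun u _ => by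
    have hbelow : HasDerivAt (fun u : ℝ => poissonBelow (k + u) (k + 1))
        (-poissonMass (k + u) k) u :=
      (hasDerivAt_poissonBelow_succ k (k + u)).comp_const_add (k : ℝ) u
    have hcubic : HasDerivAt (fun u : ℝ => u - u ^ 3 / (6 * k)) (1 - u ^ 2 / (2 * k)) u :=
      ((hasDerivAt_id u).sub ((hasDerivAt_pow 3 u).div_const (6 * (k : ℝ)))).congr_deriv
        (by field_simp; norm_num; ring)
    exact (hbelow.add (hcubic.mul_const p)).hasDerivWithinAt
  have hbound : ∀ u ∈ Set.Icc (-2 : ℝ) 2,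
      ‖-poissonMass (k + u) k + (1 - u ^ 2 / (2 * k)) * p‖ ≤ 52 / (k : ℝ) ^ 2 * p := fun u hu => by
    rw [Real.norm_eq_abs, neg_add_eq_sub, abs_sub_comm]
    exact abs_poissonMass_add_sub_le hk (abs_le.2 hu)
  have hmean := (convex_Icc (-2 : ℝ) 2).norm_image_sub_le_of_norm_hasDerivWithin_le hderiv hbound
    (x := d) (y := d + 1) ⟨by linarith, by linarith⟩ ⟨by linarith, by linarith⟩
  rw [add_sub_cancel_left, norm_one, mul_one, Real.norm_eq_abs] at hmean
  convert! hmean using 2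
  rw [← add_assoc]
  field_simp
  ring

lemma abs_poissonMass_add_one_succ_sub_le {k : ℕ} {d : ℝ} (hk : 6 ≤ k) (hd : |d| ≤ 1) :
    |poissonMass (k + d + 1) (k + 1) - (1 - (d ^ 2 + 1) / (2 * k)) * poissonMass k k| ≤
      107 / (k : ℝ) ^ 2 * poissonMass k k := by
  have hk0 : (0 : ℝ) < k := by exact_mod_cast (by omega : 0 < k)
  set p := poissonMass k k
  have hp : 0 ≤ p := (poissonMass_pos hk0 k).le
  obtain ⟨hd₁, hd₂⟩ := abs_le.1 hd
  have hmass : |poissonMass (k + d + 1) k - (1 - (d + 1) ^ 2 / (2 * k)) * p| ≤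
      52 / (k : ℝ) ^ 2 * p := by
    rw [add_assoc]
    exact abs_poissonMass_add_sub_le hk (abs_le.2 ⟨by linarith, by linarith⟩)
  have hfactor : |(k + d + 1) / (k + 1)| ≤ 2 := by
    rw [abs_of_nonneg (div_nonneg (by linarith) (by linarith)), div_le_iff₀ (by linarith)]
    linarith
  have hrest : |d * (2 + (d + 1) ^ 2) / (2 * k * (k + 1))| ≤ 3 / (k : ℝ) ^ 2 := by
    have hden : (0 : ℝ) < 2 * k * (k + 1) := by positivity
    have hnum : |d * (2 + (d + 1) ^ 2)| ≤ 6 := by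
      rw [abs_mul, abs_of_nonneg (a := 2 + (d + 1) ^ 2) (by positivity)]
      nlinarith [abs_nonneg d]
    rw [abs_div, abs_of_pos hden, div_le_div_iff₀ hden (by positivity)]
    nlinarith
  have hsplit : poissonMass (k + d + 1) (k + 1) - (1 - (d ^ 2 + 1) / (2 * k)) * p =
      (k + d + 1) / (k + 1) * (poissonMass (k + d + 1) k - (1 - (d + 1) ^ 2 / (2 * k)) * p) -
        d * (2 + (d + 1) ^ 2) / (2 * k * (k + 1)) * p := by
    rw [poissonMass_succ]
    field_simp
    ring
  calc |poissonMass (k + d + 1) (k + 1) - (1 - (d ^ 2 + 1) / (2 * k)) * p|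
      ≤ |(k + d + 1) / (k + 1)| *
            |poissonMass (k + d + 1) k - (1 - (d + 1) ^ 2 / (2 * k)) * p| +
          |d * (2 + (d + 1) ^ 2) / (2 * k * (k + 1))| * |p| := by
        rw [hsplit, ← abs_mul, ← abs_mul]
        exact abs_sub _ _
    _ ≤ 2 * (52 / (k : ℝ) ^ 2 * p) + 3 / (k : ℝ) ^ 2 * p := by rw [abs_of_nonneg hp]; gcongr
    _ = 107 / (k : ℝ) ^ 2 * p := by ring

lemma abs_jitteredPoissonCDF_add_one_sub_le {k : ℕ} {d t : ℝ} (hk : 6 ≤ k) (hd : |d| ≤ 1)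
    (ht : t ∈ Set.Icc (0 : ℝ) 1) :
    |jitteredPoissonCDF (k + d + 1) (k + 1) t - jitteredPoissonCDF (k + d) k t -
        (d + 1 / 3 - t) / (2 * k) * poissonMass k k| ≤
      159 / (k : ℝ) ^ 2 * poissonMass k k := by
  have hk0 : (0 : ℝ) < k := by exact_mod_cast (by omega : 0 < k)
  obtain ⟨ht₀, ht₁⟩ := ht
  have hbelow := abs_poissonBelow_add_one_sub_le hk hd
  have hmass := abs_poissonMass_add_sub_le hk (hd.trans one_le_two)
  have hmass' := abs_poissonMass_add_one_succ_sub_le hk hd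
  set p := poissonMass k k
  have hp : 0 < p := poissonMass_pos hk0 k
  set e₁ := poissonBelow (k + d + 1) (k + 1) - poissonBelow (k + d) (k + 1) +
    (1 - (d ^ 2 + d + 1 / 3) / (2 * k)) * p
  set e₂ := poissonMass (k + d) k - (1 - d ^ 2 / (2 * k)) * p
  set e₃ := poissonMass (k + d + 1) (k + 1) - (1 - (d ^ 2 + 1) / (2 * k)) * p
  calc |jitteredPoissonCDF (k + d + 1) (k + 1) t - jitteredPoissonCDF (k + d) k t -
        (d + 1 / 3 - t) / (2 * k) * p|
      = |e₁ + ((1 - t) * e₂ + t * e₃)| := by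
        congr 1
        simp only [jitteredPoissonCDF, e₁, e₂, e₃, poissonBelow_succ (k + d) k]
        field_simp
        ring
    _ ≤ |e₁| + ((1 - t) * |e₂| + t * |e₃|) := by
        refine (abs_add_le _ _).trans (add_le_add_right ((abs_add_le _ _).trans_eq ?_) _)
        rw [abs_mul, abs_mul, abs_of_nonneg ht₀, abs_of_nonneg (sub_nonneg.2 ht₁)]
    _ ≤ 52 / (k : ℝ) ^ 2 * p +
          ((1 - t) * (107 / (k : ℝ) ^ 2 * p) + t * (107 / (k : ℝ) ^ 2 * p)) := by
        have hmass_weak : |e₂| ≤ 107 / (k : ℝ) ^ 2 * p := hmass.trans (by gcongr; norm_num)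
        gcongr
    _ = 159 / (k : ℝ) ^ 2 * p := by ring

lemma lt_of_tendsto_of_succ_lt {α : Type*} [TopologicalSpace α] [Preorder α] [ClosedIicTopology α]
    {a : ℕ → α} {L : α} {K n : ℕ} (hL : Tendsto a atTop (𝓝 L))
    (ha : ∀ k, K ≤ k → a (k + 1) < a k) (hn : K ≤ n) : L < a n := by
  have hanti : AntitoneOn a (Set.Ici K) :=
    antitoneOn_nat_Ici_of_succ_le fun k hk => (ha k hk).le
  refine lt_of_le_of_lt (le_of_tendsto hL ?_) (ha n hn)
  filter_upwards [eventually_ge_atTop (n + 1)] with k hk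
  exact hanti (Set.mem_Ici.2 (by omega)) (Set.mem_Ici.2 (by omega)) hk

lemma eventually_jitteredPoissonCDF_add_one_lt {ε : ℝ} (hε : 0 < ε) :
    ∀ᶠ k : ℕ in atTop, ∀ d t : ℝ, |d| ≤ 1 → t ∈ Set.Icc (0 : ℝ) 1 →
      (ε ≤ t - d - 1 / 3 →
        jitteredPoissonCDF (k + d + 1) (k + 1) t < jitteredPoissonCDF (k + d) k t) ∧
      (ε ≤ d + 1 / 3 - t →
        jitteredPoissonCDF (k + d) k t < jitteredPoissonCDF (k + d + 1) (k + 1) t) := by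
  filter_upwards [eventually_ge_atTop 6, eventually_gt_atTop ⌈318 / ε⌉₊] with k hk hkε d t hd ht
  have hk0 : (0 : ℝ) < k := by exact_mod_cast (by omega : 0 < k)
  have hp : 0 < poissonMass k k := poissonMass_pos hk0 k
  have hkε' : 318 < k * ε := (div_lt_iff₀ hε).1 (Nat.lt_of_ceil_lt hkε)
  have herror : 159 / (k : ℝ) ^ 2 * poissonMass k k < ε / (2 * k) * poissonMass k k := by
    gcongr ?_ * _
    rw [div_lt_div_iff₀ (by positivity) (by positivity)]
    nlinarith
  have hstep := abs_le.1 (abs_jitteredPoissonCDF_add_one_sub_le hk hd ht)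
  constructor <;> intro h
  · have hdrift : (d + 1 / 3 - t) / (2 * k) * poissonMass k k ≤
        -(ε / (2 * k) * poissonMass k k) := by
      rw [← neg_mul, ← neg_div]
      gcongr
      linarith
    linarith [hstep.2]
  · have hdrift : ε / (2 * k) * poissonMass k k ≤
        (d + 1 / 3 - t) / (2 * k) * poissonMass k k := by gcongr
    linarith [hstep.1]

lemma charFun_map_poissonMeasure (r : ℝ≥0) (c b t : ℝ) :
    charFun ((poissonMeasure r).map (fun k : ℕ => c * (k : ℝ) + b)) t =
      Complex.exp (r * (Complex.exp (c * t * Complex.I) - 1) + b * t * Complex.I) := by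
  have hcomp : (fun k : ℕ => c * (k : ℝ) + b) = (· + b) ∘ (c * ·) ∘ (Nat.cast : ℕ → ℝ) := rfl
  rw [hcomp, ← Measure.map_map (by fun_prop) (by fun_prop),
    ← Measure.map_map (by fun_prop) (by fun_prop), charFun_map_add_const, charFun_map_mul,
    charFun_map_cast_poissonMeasure, ← Complex.exp_add]
  simp [mul_comm]

lemma tendsto_mul_exp_div_sqrt_mul_I_sub (t : ℝ) :
    Tendsto (fun s : ℝ => s * (Complex.exp (t / √s * Complex.I) - 1 - t / √s * Complex.I)) atTop
      (𝓝 (-t ^ 2 / 2)) := by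
  set z : ℝ → ℂ := fun s => t / √s * Complex.I
  have hz : Tendsto z atTop (𝓝 0) := by
    have hreal : Tendsto (fun s : ℝ => t / √s) atTop (𝓝 0) :=
      Real.tendsto_sqrt_atTop.const_div_atTop t
    simpa [z] using ((Complex.continuous_ofReal.tendsto _).comp hreal).mul_const Complex.I
  have hz_sq : ∀ᶠ s : ℝ in atTop, s * z s ^ 2 = -t ^ 2 := by
    filter_upwards [eventually_gt_atTop 0] with s hs
    have hsqrt : (√s : ℂ) ^ 2 = s := by exact_mod_cast congrArg Complex.ofReal (Real.sq_sqrt hs.le)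
    have hs' : (s : ℂ) ≠ 0 := by exact_mod_cast hs.ne'
    simp only [z, mul_pow, div_pow, hsqrt, Complex.I_sq]
    field_simp
  have hremainder : Tendsto (fun s : ℝ => s * (Complex.exp (z s) -
      ∑ i ∈ Finset.range 3, z s ^ i / i.factorial)) atTop (𝓝 0) := by
    refine (Asymptotics.isLittleO_one_iff ℂ).1 ?_
    have hsmall := (Asymptotics.isBigO_refl (fun s : ℝ => (s : ℂ)) atTop).mul_isLittleO
      ((Complex.exp_sub_sum_range_succ_isLittleO_pow 2).comp_tendsto hz)
    exact (hsmall.congr' .rfl hz_sq).trans_isBigO (Asymptotics.isBigO_const_const _ one_ne_zero _)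
  rw [← zero_add (-(t : ℂ) ^ 2 / 2)]
  refine (hremainder.add_const _).congr' ?_
  filter_upwards [hz_sq] with s hs
  change _ = s * (Complex.exp (z s) - 1 - z s)
  generalize z s = w at hs ⊢
  simp only [Finset.sum_range_succ, Finset.sum_range_zero, Nat.factorial]
  push_cast
  linear_combination -hs / 2

lemma tendsto_charFun_map_poissonMeasure {r : ℕ → ℝ≥0} {a : ℕ → ℝ} (hr : Tendsto r atTop atTop)
    (ha : Tendsto (fun n => (r n - a n) / √(r n)) atTop (𝓝 0)) (t : ℝ) :
    Tendsto (fun n => charFun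
      ((poissonMeasure (r n)).map (fun k : ℕ => (√(r n))⁻¹ * (k : ℝ) + -(a n / √(r n)))) t) atTop
      (𝓝 (charFun (gaussianReal 0 1) t)) := by
  have hr' : Tendsto (fun n => (r n : ℝ)) atTop atTop := NNReal.tendsto_coe_atTop.2 hr
  have hdrift : Tendsto (fun n => (((r n - a n) / √(r n) : ℝ) : ℂ) * (t * Complex.I)) atTop
      (𝓝 0) := by
    simpa using ((Complex.continuous_ofReal.tendsto _).comp ha).mul_const (t * Complex.I)
  have hexponent := ((tendsto_mul_exp_div_sqrt_mul_I_sub t).comp hr').add hdrift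
  simp_rw [charFun_map_poissonMeasure, charFun_gaussianReal]
  refine (Complex.continuous_exp.tendsto _).comp (hexponent.congr' ?_ |>.trans_eq ?_)
  · filter_upwards [hr'.eventually_gt_atTop 0] with n hn
    have hsqrt : (√(r n) : ℂ) ^ 2 = (r n : ℝ) := by
      exact_mod_cast congrArg Complex.ofReal (Real.sq_sqrt hn.le)
    have hsqrt_ne : (√(r n) : ℂ) ≠ 0 := by exact_mod_cast (Real.sqrt_pos.2 hn).ne'
    simp only [Function.comp_apply]
    push_cast
    rw [← hsqrt]
    field_simp
    ring
  · congr 2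
    push_cast
    ring

lemma poissonMeasure_real_Iio (r : ℝ≥0) (k : ℕ) :
    (poissonMeasure r).real (Set.Iio k) = poissonBelow r k := by
  rw [← Finset.coe_Iio, ← sum_measureReal_singleton, Nat.Iio_eq_range]
  simp_rw [poissonMeasure_real_singleton]
  rfl

lemma gaussianReal_real_Iio_zero : (gaussianReal 0 1).real (Set.Iio 0) = 1 / 2 := by
  have := nullSingletonClass_gaussianReal (μ := 0) (v := 1) one_ne_zero
  have hsymm : (gaussianReal 0 1).real (Set.Iio 0) = (gaussianReal 0 1).real (Set.Ioi 0) := by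
    conv_lhs => rw [← neg_zero, ← gaussianReal_map_neg]
    rw [map_measureReal_apply (by fun_prop) measurableSet_Iio]
    simp
  have hcompl := probReal_compl_eq_one_sub (μ := gaussianReal 0 1)
    (measurableSet_Iio (a := (0 : ℝ)))
  rw [Set.compl_Iio, measureReal_congr (Ioi_ae_eq_Ici (μ := gaussianReal 0 1)).symm] at hcompl
  linarith

lemma tendsto_poissonBelow {r : ℕ → ℝ≥0} {k : ℕ → ℕ} (hr : Tendsto r atTop atTop)
    (hk : Tendsto (fun n => (r n - k n) / √(r n)) atTop (𝓝 0)) :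
    Tendsto (fun n => poissonBelow (r n) (k n)) atTop (𝓝 (1 / 2)) := by
  let μ : ℕ → ProbabilityMeasure ℝ := fun n =>
    ⟨(poissonMeasure (r n)).map (fun j : ℕ => (√(r n))⁻¹ * (j : ℝ) + -(k n / √(r n))),
      Measure.isProbabilityMeasure_map (by fun_prop)⟩
  let μ₀ : ProbabilityMeasure ℝ := ⟨gaussianReal 0 1, inferInstance⟩
  have hμ : Tendsto μ atTop (𝓝 μ₀) :=
    ProbabilityMeasure.tendsto_iff_tendsto_charFun.2 (tendsto_charFun_map_poissonMeasure hr hk)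
  have hfrontier : (μ₀ : Measure ℝ) (frontier (Set.Iio 0)) = 0 := by
    have := nullSingletonClass_gaussianReal (μ := 0) (v := 1) one_ne_zero
    rw [frontier_Iio]
    exact measure_singleton (μ := gaussianReal 0 1) 0
  have hlimit := (ENNReal.tendsto_toReal (measure_ne_top (gaussianReal 0 1) (Set.Iio 0))).comp
    (ProbabilityMeasure.tendsto_measure_of_null_frontier_of_tendsto' hμ hfrontier)
  rw [← measureReal_def, gaussianReal_real_Iio_zero] at hlimit
  refine hlimit.congr' ?_
  filter_upwards [hr.eventually_gt_atTop 0] with n hn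
  have hsqrt : 0 < √(r n) := Real.sqrt_pos.2 (by exact_mod_cast hn)
  have hpreimage : (fun j : ℕ => (√(r n))⁻¹ * (j : ℝ) + -(k n / √(r n))) ⁻¹' Set.Iio 0 =
      Set.Iio (k n) := by
    ext j
    simp only [Set.mem_preimage, Set.mem_Iio, ← sub_eq_add_neg, sub_neg, inv_mul_eq_div,
      div_lt_div_iff_of_pos_right hsqrt, Nat.cast_lt]
  rw [← poissonMeasure_real_Iio, ← hpreimage]
  exact congrArg ENNReal.toReal (Measure.map_apply (by fun_prop) measurableSet_Iio)

lemma tendsto_poissonBelow_add (d : ℝ) :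
    Tendsto (fun k : ℕ => poissonBelow (k + d) k) atTop (𝓝 (1 / 2)) := by
  have hmean : Tendsto (fun k : ℕ => (k : ℝ) + d) atTop atTop :=
    tendsto_atTop_add_const_right _ d tendsto_natCast_atTop_atTop
  have hcoe : ∀ᶠ k : ℕ in atTop, (((k : ℝ) + d).toNNReal : ℝ) = k + d := by
    filter_upwards [hmean.eventually_ge_atTop 0] with k hk
    exact Real.coe_toNNReal _ hk
  refine (tendsto_poissonBelow (tendsto_real_toNNReal_atTop.comp hmean) (k := id) ?_).congr' ?_
  · refine ((Real.tendsto_sqrt_atTop.comp hmean).const_div_atTop d).congr' ?_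
    filter_upwards [hcoe] with k hk
    simp [hk]
  · filter_upwards [hcoe] with k hk
    simp [hk]

lemma tendsto_jitteredPoissonCDF_add (d t : ℝ) :
    Tendsto (fun k : ℕ => jitteredPoissonCDF (k + d) k t) atTop (𝓝 (1 / 2)) := by
  have hsucc : Tendsto (fun k : ℕ => poissonBelow (k + d) (k + 1)) atTop (𝓝 (1 / 2)) := by
    refine ((tendsto_poissonBelow_add (d - 1)).comp (tendsto_add_atTop_nat 1)).congr fun k => ?_
    simp only [Function.comp_apply, Nat.cast_succ, add_add_sub_cancel]
  have hmix := ((tendsto_poissonBelow_add d).const_mul (1 - t)).add (hsucc.const_mul t)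
  rw [← add_mul, sub_add_cancel, one_mul] at hmix
  refine hmix.congr fun k => ?_
  rw [jitteredPoissonCDF, poissonBelow_succ]
  ring

lemma eventually_jitteredPoissonCDF_side_of_half {ε : ℝ} (hε : 0 < ε) :
    ∀ᶠ k : ℕ in atTop, ∀ d t : ℝ, |d| ≤ 1 → t ∈ Set.Icc (0 : ℝ) 1 →
      (ε ≤ t - d - 1 / 3 → 1 / 2 < jitteredPoissonCDF (k + d) k t) ∧
      (ε ≤ d + 1 / 3 - t → jitteredPoissonCDF (k + d) k t < 1 / 2) := by
  obtain ⟨K, hK⟩ := eventually_atTop.1 (eventually_jitteredPoissonCDF_add_one_lt hε)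
  filter_upwards [eventually_ge_atTop K] with k hk d t hd ht
  have hlim := tendsto_jitteredPoissonCDF_add d t
  have hcast (j : ℕ) : ((j + 1 : ℕ) : ℝ) + d = j + d + 1 := by push_cast; ring
  refine ⟨fun h => lt_of_tendsto_of_succ_lt hlim (fun j hj => ?_) hk, fun h =>
    neg_lt_neg_iff.1 (lt_of_tendsto_of_succ_lt hlim.neg (fun j hj => ?_) hk)⟩
  · rw [hcast]
    exact (hK j hj d t hd ht).1 h
  · rw [hcast]
    exact neg_lt_neg ((hK j hj d t hd ht).2 h)

lemma cdf_conv (μ ν : Measure ℝ) [IsProbabilityMeasure μ] [IsProbabilityMeasure ν] (x : ℝ) :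
    cdf (μ ∗ ν) x = ∫ a, cdf ν (x - a) ∂μ := by
  have hint : Integrable ((Set.Iic x).indicator (1 : ℝ → ℝ)) (μ ∗ ν) :=
    (integrable_const 1).indicator measurableSet_Iic
  rw [cdf_eq_real, ← integral_indicator_one measurableSet_Iic, integral_conv hint]
  refine integral_congr_ae (.of_forall fun a => ?_)
  have hslice (b : ℝ) : (Set.Iic x).indicator (1 : ℝ → ℝ) (a + b) =
      (Set.Iic (x - a)).indicator 1 b := by
    simp only [Set.indicator, Set.mem_Iic, le_sub_iff_add_le', Pi.one_apply]
  simp only [hslice]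
  rw [integral_indicator_one measurableSet_Iic, cdf_eq_real]

instance : IsProbabilityMeasure (cond volume (Set.Ioo (0 : ℝ) 1)) :=
  cond_isProbabilityMeasure_of_finite (by simp) (by simp)

lemma cdf_cond_volume_Ioo_zero_one (x : ℝ) :
    cdf (cond volume (Set.Ioo (0 : ℝ) 1)) x = max 0 (min x 1) := by
  have hae : (Set.Ioo (0 : ℝ) 1 ∩ Set.Iic x : Set ℝ) =ᵐ[volume] Set.Ioc 0 (min x 1) := by
    rw [min_comm, ← Set.Ioc_inter_Iic]
    exact Ioo_ae_eq_Ioc.inter (ae_eq_refl _)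
  rw [cdf_eq_real, measureReal_def, cond_apply measurableSet_Ioo, measure_congr hae,
    Real.volume_Ioo, Real.volume_Ioc, sub_zero, sub_zero, ENNReal.ofReal_one, inv_one, one_mul,
    ENNReal.toReal_ofReal', max_comm]

/-- The law of `N + U`, where `N` is Poisson with mean `r` and `U` is independent of `N` and
uniform on `(0, 1)`. -/
noncomputable def jitteredPoissonMeasure (r : ℝ≥0) : Measure ℝ :=
  (poissonMeasure r).map (Nat.cast : ℕ → ℝ) ∗ cond volume (Set.Ioo (0 : ℝ) 1)

instance (r : ℝ≥0) : IsProbabilityMeasure (jitteredPoissonMeasure r) := by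
  unfold jitteredPoissonMeasure
  infer_instance

lemma cdf_jitteredPoissonMeasure (r : ℝ≥0) (k : ℕ) {t : ℝ} (ht : t ∈ Set.Icc (0 : ℝ) 1) :
    cdf (jitteredPoissonMeasure r) (k + t) = jitteredPoissonCDF r k t := by
  have hbelow {j : ℕ} (hj : j < k) : max 0 (min ((k : ℝ) + t - j) 1) = 1 := by
    have : (j : ℝ) + 1 ≤ k := by exact_mod_cast hj
    rw [min_eq_right (by linarith [ht.1]), max_eq_right zero_le_one]
  have hat : max 0 (min ((k : ℝ) + t - k) 1) = t := by
    rw [add_sub_cancel_left, min_eq_left ht.2, max_eq_right ht.1]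
  have habove {j : ℕ} (hj : j ∉ Finset.range (k + 1)) : max 0 (min ((k : ℝ) + t - j) 1) = 0 := by
    have : (k : ℝ) + 1 ≤ j := by exact_mod_cast not_lt.1 (Finset.mem_range.not.1 hj)
    exact max_eq_left ((min_le_left _ _).trans (by linarith [ht.2]))
  have hmeas : Measurable fun a : ℝ => cdf (cond volume (Set.Ioo (0 : ℝ) 1)) (k + t - a) :=
    (monotone_cdf _).measurable.comp (by fun_prop)
  rw [jitteredPoissonMeasure, cdf_conv,
    integral_map .of_discrete hmeas.aestronglyMeasurable, integral_poissonMeasure]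
  simp only [cdf_cond_volume_Ioo_zero_one, smul_eq_mul]
  rw [tsum_eq_sum (s := Finset.range (k + 1)) fun j hj => by rw [habove hj, mul_zero],
    Finset.sum_range_succ, hat, mul_comm _ t]
  refine congrArg (· + _) (Finset.sum_congr rfl fun j hj => ?_)
  rw [hbelow (Finset.mem_range.1 hj), mul_one, poissonMass]

lemma strictMonoOn_cdf_jitteredPoissonMeasure {r : ℝ≥0} (hr : 0 < r) :
    StrictMonoOn (cdf (jitteredPoissonMeasure r)) (Set.Ici 0) := by
  intro x hx y _ hxy
  set k := ⌊x⌋₊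
  have hk : (k : ℝ) ≤ x := Nat.floor_le hx
  have hk' : x < k + 1 := Nat.lt_floor_add_one x
  set z := min y (k + 1)
  have hxz : x < z := lt_min hxy hk'
  have hz : z ≤ k + 1 := min_le_right _ _
  have hmass : 0 < poissonMass r k := poissonMass_pos (by exact_mod_cast hr) k
  calc cdf (jitteredPoissonMeasure r) x = jitteredPoissonCDF r k (x - k) := by
        rw [← cdf_jitteredPoissonMeasure r k ⟨by linarith, by linarith⟩, add_sub_cancel]
    _ < jitteredPoissonCDF r k (z - k) := by
        unfold jitteredPoissonCDF
        gcongr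
    _ = cdf (jitteredPoissonMeasure r) z := by
        rw [← cdf_jitteredPoissonMeasure r k ⟨by linarith, by linarith⟩, add_sub_cancel]
    _ ≤ cdf (jitteredPoissonMeasure r) y := monotone_cdf _ (min_le_left _ _)

lemma rvMedian_eq_of_hasLaw {Ω : Type*} [MeasurableSpace Ω] {P : Measure Ω} {X : Ω → ℝ}
    {μ : Measure ℝ} (hX : HasLaw X μ P) : rvMedian P X = rvMedian μ id := by
  simp only [rvMedian, hX.measureReal_eq measurableSet_Iic, id]

lemma rvMedian_id_le_iff {μ : Measure ℝ} [IsProbabilityMeasure μ] {x : ℝ} :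
    rvMedian μ id ≤ x ↔ 1 / 2 ≤ cdf μ x := by
  have hrv : rvMedian μ id = sInf {y | 1 / 2 ≤ cdf μ y} := by
    simp only [rvMedian, cdf_eq_real, id, Set.Iic]
  have hnonempty : {y | 1 / 2 ≤ cdf μ y}.Nonempty :=
    ((tendsto_cdf_atTop μ).eventually_const_le one_half_lt_one).exists
  have hbdd : BddBelow {y | 1 / 2 ≤ cdf μ y} := by
    obtain ⟨a, ha⟩ := ((tendsto_cdf_atBot μ).eventually_lt_const one_half_pos).exists
    exact ⟨a, fun y hy => ((monotone_cdf μ).reflect_lt (ha.trans_le hy)).le⟩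
  rw [hrv]
  refine ⟨fun h => ?_, fun h => csInf_le hbdd h⟩
  refine ge_of_tendsto (((cdf μ).right_continuous x).tendsto.mono_left
    (nhdsWithin_mono x Set.Ioi_subset_Ici_self)) ?_
  filter_upwards [self_mem_nhdsWithin] with y hy
  obtain ⟨z, hz, hzy⟩ := exists_lt_of_csInf_lt hnonempty (h.trans_lt hy)
  exact hz.trans (monotone_cdf μ hzy.le)

lemma lt_rvMedian_id_iff {μ : Measure ℝ} [IsProbabilityMeasure μ] {x : ℝ} :
    x < rvMedian μ id ↔ cdf μ x < 1 / 2 := by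
  rw [← not_le, rvMedian_id_le_iff, not_le]

lemma half_lt_cdf_of_rvMedian_jitteredPoissonMeasure_lt {r : ℝ≥0} (hr : 0 < r) {x : ℝ}
    (hx : rvMedian (jitteredPoissonMeasure r) id < x) :
    1 / 2 < cdf (jitteredPoissonMeasure r) x := by
  have hzero : cdf (jitteredPoissonMeasure r) 0 = 0 := by
    simpa [jitteredPoissonCDF, poissonBelow] using
      cdf_jitteredPoissonMeasure r 0 (Set.left_mem_Icc.2 zero_le_one)
  have hpos : 0 < rvMedian (jitteredPoissonMeasure r) id :=
    lt_rvMedian_id_iff.2 (by rw [hzero]; exact one_half_pos)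
  exact (rvMedian_id_le_iff.1 le_rfl).trans_lt
    (strictMonoOn_cdf_jitteredPoissonMeasure hr hpos.le (hpos.trans hx).le hx)

lemma eventually_cdf_jitteredPoissonMeasure_side_of_half {ε : ℝ} (hε : 0 < ε) :
    ∀ᶠ r : ℝ≥0 in atTop, ∀ u ∈ Set.Icc (0 : ℝ) 1,
      (1 / 3 + ε ≤ u → 1 / 2 < cdf (jitteredPoissonMeasure r) (r + u)) ∧
      (u ≤ 1 / 3 - ε → cdf (jitteredPoissonMeasure r) (r + u) < 1 / 2) := by
  obtain ⟨K, hK⟩ := eventually_atTop.1 (eventually_jitteredPoissonCDF_side_of_half hε)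
  filter_upwards [eventually_ge_atTop (K : ℝ≥0)] with r hr u hu
  have hKr : (K : ℝ) ≤ r := by exact_mod_cast hr
  set k := ⌊(r : ℝ) + u⌋₊
  have hk : (k : ℝ) ≤ r + u := Nat.floor_le (add_nonneg r.coe_nonneg hu.1)
  have hk' : (r : ℝ) + u < k + 1 := Nat.lt_floor_add_one _
  have ht : (r : ℝ) + u - k ∈ Set.Icc (0 : ℝ) 1 := ⟨by linarith, by linarith⟩
  have hd : |(r : ℝ) - k| ≤ 1 := abs_le.2 ⟨by linarith [hu.2], by linarith [hu.1]⟩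
  have hside := hK k (Nat.le_floor (hKr.trans (le_add_of_nonneg_right hu.1))) _ _ hd ht
  rw [add_sub_cancel, ← cdf_jitteredPoissonMeasure r k ht, add_sub_cancel] at hside
  exact ⟨fun h => hside.1 (by linarith), fun h => hside.2 (by linarith)⟩

lemma tendsto_rvMedian_jitteredPoissonMeasure_sub :
    Tendsto (fun r : ℝ≥0 => rvMedian (jitteredPoissonMeasure r) id - r) atTop (𝓝 (1 / 3)) := by
  refine Metric.tendsto_nhds.2 fun ε hε => ?_
  set δ := min (ε / 2) (1 / 3)
  have hδ : 0 < δ := by positivity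
  have hδε : δ < ε := (min_le_left _ _).trans_lt (half_lt_self hε)
  have hδ' : δ ≤ 1 / 3 := min_le_right _ _
  filter_upwards [eventually_cdf_jitteredPoissonMeasure_side_of_half hδ] with r hr
  have hupper : rvMedian (jitteredPoissonMeasure r) id ≤ r + (1 / 3 + δ) :=
    rvMedian_id_le_iff.2 ((hr _ ⟨by linarith, by linarith⟩).1 le_rfl).le
  have hlower : r + (1 / 3 - δ) < rvMedian (jitteredPoissonMeasure r) id :=
    lt_rvMedian_id_iff.2 ((hr _ ⟨by linarith, by linarith⟩).2 le_rfl)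
  rw [Real.dist_eq, abs_lt]
  constructor <;> linarith

lemma tendsto_measure_le_abs_sub_of_tendstoInMeasure_const {Ω : Type*} [MeasurableSpace Ω]
    {P : Measure Ω} {ι : Type*} {l : Filter ι} {f : ι → Ω → ℝ} {a b ε : ℝ}
    (hf : TendstoInMeasure P f l fun _ => a) (hab : |a - b| < ε) :
    Tendsto (fun n => P {ω | ε ≤ |f n ω - b|}) l (𝓝 0) := by
  refine tendsto_of_tendsto_of_tendsto_of_le_of_le tendsto_const_nhds
    (tendstoInMeasure_iff_norm.1 hf (ε - |a - b|) (sub_pos.2 hab)) (fun _ => zero_le)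
    fun n => measure_mono fun ω (hω : ε ≤ |f n ω - b|) => ?_
  exact sub_le_iff_le_add.2 (hω.trans (abs_sub_le _ a _))

lemma natCard_subtype_mem_eq_sum_indicator {E : Type*} (z : ℕ → E) (S : Set E) (n : ℕ) :
    (Nat.card {i : Fin n // z i ∈ S} : ℝ) = ∑ i ∈ Finset.range n, S.indicator 1 (z i) := by
  classical
  rw [Nat.card_eq_fintype_card, Fintype.card_subtype, Finset.card_filter, Nat.cast_sum,
    ← Fin.sum_univ_eq_sum_range (fun i => S.indicator (1 : E → ℝ) (z i))]
  simp only [Set.indicator_apply, Pi.one_apply, Nat.cast_ite, Nat.cast_one, Nat.cast_zero]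

section EmpiricalFrequency

variable {Ω E : Type*} [MeasurableSpace Ω] [MeasurableSpace E] {P : Measure Ω}
  {Z : ℕ → Ω → E} {μ : Measure E} [IsProbabilityMeasure μ]

lemma tendstoInMeasure_natCard_div (hindep : Pairwise fun i j => IndepFun (Z i) (Z j) P)
    (hlaw : ∀ i, HasLaw (Z i) μ P) {S : Set E} (hS : MeasurableSet S) :
    TendstoInMeasure P (fun n ω => (Nat.card {i : Fin n // Z i ω ∈ S} : ℝ) / n) atTop
      fun _ => μ.real S := by
  have := (hlaw 0).isProbabilityMeasure
  have hindicator : Measurable (S.indicator (1 : E → ℝ)) := measurable_one.indicator hS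
  have hmeas (i : ℕ) : AEMeasurable (fun ω => S.indicator (1 : E → ℝ) (Z i ω)) P :=
    hindicator.comp_aemeasurable (hlaw i).aemeasurable
  have hmean : ∫ ω, S.indicator (1 : E → ℝ) (Z 0 ω) ∂P = μ.real S :=
    ((hlaw 0).integral_comp hindicator.aestronglyMeasurable).trans (integral_indicator_one hS)
  have hint : Integrable (fun ω => S.indicator (1 : E → ℝ) (Z 0 ω)) P :=
    .of_bound (hmeas 0).aestronglyMeasurable 1 <| .of_forall fun ω =>
      (norm_indicator_le_norm_self _ _).trans_eq norm_one
  have hslln := strong_law_ae_real (fun i ω => S.indicator (1 : E → ℝ) (Z i ω)) hint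
    (fun i j hij => (hindep hij).comp hindicator hindicator)
    fun i => ((hlaw i).identDistrib (hlaw 0)).comp hindicator
  have hsum (n : ℕ) (ω : Ω) : (Nat.card {i : Fin n // Z i ω ∈ S} : ℝ) =
      ∑ i ∈ Finset.range n, S.indicator 1 (Z i ω) :=
    natCard_subtype_mem_eq_sum_indicator (fun i => Z i ω) S n
  simp_rw [hsum, ← hmean]
  exact tendstoInMeasure_of_tendsto_ae (fun n =>
    ((Finset.aemeasurable_fun_sum _ fun i _ => hmeas i).div_const _).aestronglyMeasurable) hslln

lemma tendsto_measure_half_le_natCard (hindep : Pairwise fun i j => IndepFun (Z i) (Z j) P)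
    (hlaw : ∀ i, HasLaw (Z i) μ P) {S : Set E} (hS : MeasurableSet S)
    (hlt : μ.real S < 1 / 2) :
    Tendsto (fun n : ℕ => P {ω | n ≤ 2 * Nat.card {i : Fin n // Z i ω ∈ S}}) atTop (𝓝 0) := by
  have hfrequency := tendsto_measure_le_abs_sub_of_tendstoInMeasure_const (ε := 1 / 2 - μ.real S)
    (tendstoInMeasure_natCard_div hindep hlaw hS) (by rw [sub_self, abs_zero]; linarith)
  refine tendsto_of_tendsto_of_tendsto_of_le_of_le' tendsto_const_nhds hfrequency
    (.of_forall fun _ => zero_le) ?_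
  filter_upwards [eventually_gt_atTop 0] with n hn
  refine measure_mono fun ω (hω : n ≤ 2 * _) => ?_
  have hω' : (n : ℝ) ≤ 2 * Nat.card {i : Fin n // Z i ω ∈ S} := by exact_mod_cast hω
  have hhalf : 1 / 2 ≤ (Nat.card {i : Fin n // Z i ω ∈ S} : ℝ) / n := by
    rw [le_div_iff₀ (by exact_mod_cast hn)]
    linarith
  exact (sub_le_sub_right hhalf _).trans (le_abs_self _)

end EmpiricalFrequency

lemma IsSampleMedian.le_two_mul_natCard_Iic {n : ℕ} {z : Fin n → ℝ} {m x : ℝ}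
    (h : IsSampleMedian z m) (hx : m ≤ x) : n ≤ 2 * Nat.card {i : Fin n // z i ∈ Set.Iic x} :=
  h.1.trans <| Nat.mul_le_mul_left 2 <|
    Nat.card_mono (Set.toFinite {i | z i ∈ Set.Iic x}) fun _ hi => le_trans hi hx

lemma IsSampleMedian.le_two_mul_natCard_Ioi {n : ℕ} {z : Fin n → ℝ} {m x : ℝ}
    (h : IsSampleMedian z m) (hx : x < m) : n ≤ 2 * Nat.card {i : Fin n // z i ∈ Set.Ioi x} :=
  h.2.trans <| Nat.mul_le_mul_left 2 <|
    Nat.card_mono (Set.toFinite {i | z i ∈ Set.Ioi x}) fun _ hi => lt_of_lt_of_le hx hi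

lemma tendstoInMeasure_sampleMedian {Ω : Type*} [MeasurableSpace Ω] {P : Measure Ω}
    {Z : ℕ → Ω → ℝ} {μ : Measure ℝ} [IsProbabilityMeasure μ]
    (hindep : Pairwise fun i j => IndepFun (Z i) (Z j) P)
    (hlaw : ∀ i, HasLaw (Z i) μ P) {M : ℕ → Ω → ℝ}
    (hM : ∀ᶠ n in atTop, ∀ᵐ ω ∂P, IsSampleMedian (fun i : Fin n => Z i ω) (M n ω)) {m : ℝ}
    (hbelow : ∀ x < m, cdf μ x < 1 / 2) (habove : ∀ x > m, 1 / 2 < cdf μ x) :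
    TendstoInMeasure P M atTop fun _ => m := by
  refine tendstoInMeasure_iff_norm.2 fun ε hε => ?_
  have hleft : μ.real (Set.Iic (m - ε)) < 1 / 2 := by
    rw [← cdf_eq_real]
    exact hbelow _ (by linarith)
  have hright : μ.real (Set.Ioi (m + ε / 2)) < 1 / 2 := by
    rw [← Set.compl_Iic, probReal_compl_eq_one_sub measurableSet_Iic, ← cdf_eq_real]
    linarith [habove (m + ε / 2) (by linarith)]
  have htails := (tendsto_measure_half_le_natCard hindep hlaw measurableSet_Iic hleft).add
    (tendsto_measure_half_le_natCard hindep hlaw measurableSet_Ioi hright)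
  rw [add_zero] at htails
  refine tendsto_of_tendsto_of_tendsto_of_le_of_le' tendsto_const_nhds htails
    (.of_forall fun _ => zero_le) ?_
  filter_upwards [hM] with n hn
  refine (measure_mono_ae ?_).trans (measure_union_le _ _)
  filter_upwards [hn] with ω hω hfar
  rcases le_abs.1 (show ε ≤ |M n ω - m| from hfar) with hge | hle
  · exact .inr (hω.le_two_mul_natCard_Ioi (by linarith))
  · exact .inl (hω.le_two_mul_natCard_Iic (by linarith))

namespace IsPoissonUniformSample

variable {Ω : Type*} [MeasurableSpace Ω] {P : Measure Ω} {lam : ℝ≥0}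
  {N : ℕ → Ω → ℕ} {U : ℕ → Ω → ℝ}

lemma hasLaw_natCast (h : IsPoissonUniformSample P lam N U) (i : ℕ) :
    HasLaw (fun ω => (N i ω : ℝ)) ((poissonMeasure lam).map Nat.cast) P :=
  HasLaw.fun_comp ⟨by fun_prop, rfl⟩ (h.hasLaw_poisson i)

lemma hasLaw_uniform (h : IsPoissonUniformSample P lam N U) (i : ℕ) :
    HasLaw (U i) (cond volume (Set.Ioo 0 1)) P :=
  ⟨(h.isUniform i).aemeasurable (by simp) (by simp), h.isUniform i⟩

lemma hasLaw_jittered (h : IsPoissonUniformSample P lam N U) (i : ℕ) :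
    HasLaw (jittered N U i) (jitteredPoissonMeasure lam) P :=
  (h.indep.indepFun (i := .inl i) (j := .inr i) (by simp)).hasLaw_fun_add
    (h.hasLaw_natCast i) (h.hasLaw_uniform i)

lemma pairwise_indepFun_jittered (h : IsPoissonUniformSample P lam N U) :
    Pairwise fun i j => IndepFun (jittered N U i) (jittered N U j) P := by
  intro i j hij
  have hmeas : ∀ s, AEMeasurable (Sum.elim (fun i ω => (N i ω : ℝ)) U s) P
    | .inl i => (h.hasLaw_natCast i).aemeasurable
    | .inr i => (h.hasLaw_uniform i).aemeasurable
  have hpairs := h.indep.indepFun_prodMk_prodMk₀ hmeas (.inl i) (.inr i) (.inl j) (.inr j)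
    (by simpa) (by simp) (by simp) (by simpa)
  exact hpairs.comp (φ := fun p : ℝ × ℝ => p.1 + p.2) (ψ := fun p : ℝ × ℝ => p.1 + p.2)
    (by fun_prop) (by fun_prop)

end IsPoissonUniformSample

theorem mainTheorem8_general
    (Ω : ℝ≥0 → Type*) [∀ lam, MeasurableSpace (Ω lam)] (P : ∀ lam, Measure (Ω lam))
    (Z : ∀ lam, ℕ → Ω lam → ℝ)
    (hlaw : ∀ lam, 0 < lam → ∀ i, HasLaw (Z lam i) (jitteredPoissonMeasure lam) (P lam))
    (hindep : ∀ lam, 0 < lam → Pairwise fun i j => IndepFun (Z lam i) (Z lam j) (P lam))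
    (M : ∀ lam, ℕ → Ω lam → ℝ)
    (hM : ∀ lam, 0 < lam → ∀ᶠ n in atTop, ∀ᵐ ω ∂P lam,
      IsSampleMedian (fun i : Fin n => Z lam i ω) (M lam n ω)) :
    (∀ lam, 0 < lam →
      TendstoInMeasure (P lam) (fun n ω => M lam n ω - 1 / 3) atTop
        (fun _ => rvMedian (P lam) (Z lam 0) - 1 / 3)) ∧
    (∀ ε : ℝ, 0 < ε → ∀ᶠ lam : ℝ≥0 in atTop,
      Tendsto (fun n => P lam {ω | ε ≤ |M lam n ω - 1 / 3 - (lam : ℝ)|}) atTop (𝓝 0)) := by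
  have hconsistent (lam : ℝ≥0) (hlam : 0 < lam) : TendstoInMeasure (P lam)
      (fun n ω => M lam n ω - 1 / 3) atTop (fun _ => rvMedian (P lam) (Z lam 0) - 1 / 3) := by
    rw [rvMedian_eq_of_hasLaw (hlaw lam hlam 0)]
    have hmedian := tendstoInMeasure_sampleMedian (hindep lam hlam) (hlaw lam hlam) (hM lam hlam)
      (fun _ => lt_rvMedian_id_iff.1)
      (fun _ => half_lt_cdf_of_rvMedian_jitteredPoissonMeasure_lt hlam)
    simpa only [TendstoInMeasure, edist_sub_right] using hmedian
  refine ⟨hconsistent, fun ε hε => ?_⟩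
  filter_upwards [Metric.tendsto_nhds.1 tendsto_rvMedian_jitteredPoissonMeasure_sub ε hε,
    eventually_gt_atTop 0] with lam hclose hlam
  refine tendsto_measure_le_abs_sub_of_tendstoInMeasure_const (hconsistent lam hlam) ?_
  rwa [rvMedian_eq_of_hasLaw (hlaw lam hlam 0), sub_right_comm, ← Real.dist_eq]

/-- The iterated limit `n → ∞` and then `lam → ∞`, in probability: for each fixed `lam > 0` the
sample median minus `1/3` converges in probability as `n → ∞` (to the median of `Z 0` minus `1/3`),
and for every `ε > 0` and all sufficiently large `lam`, the probability that the sample median minus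
`1/3` is at distance at least `ε` from `lam` tends to `0` as `n → ∞`. -/
theorem mainTheorem8
    (Ω : ℝ≥0 → Type*) [∀ lam, MeasurableSpace (Ω lam)]
    (P : ∀ lam, Measure (Ω lam)) [∀ lam, IsProbabilityMeasure (P lam)]
    (N : ∀ lam, ℕ → Ω lam → ℕ) (U : ∀ lam, ℕ → Ω lam → ℝ)
    (hNU : ∀ lam, 0 < lam → IsPoissonUniformSample (P lam) lam (N lam) (U lam))
    (M : ∀ lam, ℕ → Ω lam → ℝ)
    (hM : ∀ lam, 0 < lam → ∀ n, 1 ≤ n → ∀ ω,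
      IsSampleMedian (fun i : Fin n => jittered (N lam) (U lam) i ω) (M lam n ω)) :
    (∀ lam, 0 < lam →
      TendstoInMeasure (P lam) (fun n ω => M lam n ω - 1 / 3) atTop
        (fun _ => rvMedian (P lam) (jittered (N lam) (U lam) 0) - 1 / 3)) ∧
    (∀ ε : ℝ, 0 < ε → ∀ᶠ lam : ℝ≥0 in atTop,
      Tendsto (fun n => P lam {ω | ε ≤ |M lam n ω - 1 / 3 - (lam : ℝ)|}) atTop (𝓝 0)) :=
  mainTheorem8_general Ω P (fun lam => jittered (N lam) (U lam))
    (fun lam hlam => (hNU lam hlam).hasLaw_jittered)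
    (fun lam hlam => (hNU lam hlam).pairwise_indepFun_jittered) M
    fun lam hlam => (eventually_ge_atTop 1).mono fun n hn => .of_forall (hM lam hlam n hn)
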